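/- Let $G=(V,E)$ be a finite graph, possibly with loops or multiple edges (a loop contributes $2$ to the degree of its vertex). For $H\subseteq E$ let $\deg(H,v)$ be the degree of $v$ in $(V,H)$, and $\deg(G,v)=\deg(E,v)$. Given complex edge weights $\boldsymbol\lambda=(\lambda_e)_{e\in E}$ and complex activities $\mathbf u^{(v)}=(u^{(v)}_0,\dots,u^{(v)}_{\deg(G,v)})$ for $v\in V$, put $$Z(G,\boldsymbol\lambda,\mathbf u;\mathbf x)=\sum_{H\subseteq E}\Big(\prod_{e\in H}\lambda_e\Big)\prod_{v\in V}u^{(v)}_{\deg(H,v)}x_v^{\deg(H,v)},\qquad K_v(z)=\sum_{j=0}^{\deg(G,v)}\binom{\deg(G,v)}{j}u^{(v)}_jz^j .$$ Write $Z(G,\boldsymbol\lambda,\mathbf u;y^{1/2}\mathbf 1)$ for the polynomial in $y$ obtained from $Z$ by setting every $x_v=y^{1/2}$ (it is a polynomial in $y$, and does not depend on the choice of the square root, because $\sum_v\deg(H,v)=2\,\#H$). (1) Suppose that $|\lambda_e|=1$ for all $e\in E$ and that, for every $v\in V$, $\deg K_v=\deg(G,v)$ (in particular $K_v\neq0$)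 and every zero of $K_v$ has modulus $1$. Then $Z(G,\boldsymbol\lambda,\mathbf u;\mathbf x)\ne0$ whenever $|x_v|<1$ for all $v\in V$, and also whenever $|x_v|>1$ for all $v\in V$; and every zero of $Z(G,\boldsymbol\lambda,\mathbf u;y^{1/2}\mathbf 1)$ has modulus $1$. (2) If $K_v(z)=1+z+\cdots+z^{\deg(G,v)}$ for all $v\in V$, then the hypotheses of (1) on the keys $K_v$ hold, and for $\boldsymbol\lambda\equiv\mathbf 1$ $$Z(G,\mathbf 1,\mathbf u;y^{1/2}\mathbf 1)=\sum_{H\subseteq E}\frac{y^{\#H}}{\prod_{v\in V}\binom{\deg(G,v)}{\deg(H,v)}} .$$ Consequently every zero $y\in\mathbb C$ of the right-hand side has modulus $1$. (3) Let $k\ge1$ be an integer and $t$ a real number with $4t\ge\binom{2k}{k}^2$. Then every zero of $K(z)=1+\binom{2k}{k}z^k+t\,z^{2k}$ has modulus $\kappa=t^{-1/(2k)}$. If moreover $G$ is $2k$-regular, $|\lambda_e|=1$ for all $e\in E$ and $K_v=K$ for all $v\in V$, then $Z(G,\boldsymbol\lambda,\mathbf u;\mathbf x)\neq0$ whenever $|x_v|<\kappa$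 for all $v\in V$, and also whenever $|x_v|>\kappa$ for all $v\in V$; and every zero of $Z(G,\boldsymbol\lambda,\mathbf u;y^{1/2}\mathbf 1)$ has modulus $t^{-1/k}$. -/

import Mathlib

open Polynomial

namespace SubgraphZeros

variable {α β : Type*}

/-- `deg(H,v)`: the degree of the vertex `v` in the spanning subgraph of the multigraph `G` with
edge set `H`. A loop at `v` contributes `2`. The degree `deg(G,v)` is `deg G G.edgeSet v`. -/
noncomputable def deg (G : Graph α β) (H : Set β) (v : α) : ℕ :=
  {e | e ∈ H ∧ G.Inc e v}.ncard + {e | e ∈ H ∧ G.IsLoopAt e v}.ncard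

/-- The key polynomial `K_v(z) = ∑_{j=0}^d (d choose j) u_j^{(v)} z^j` with `d = deg(G,v)`.
Only the activities `u v 0, …, u v d` are used. -/
noncomputable def keyPoly (G : Graph α β) (u : α → ℕ → ℂ) (v : α) : ℂ[X] :=
  ∑ j ∈ Finset.range (deg G G.edgeSet v + 1),
    C (((deg G G.edgeSet v).choose j : ℂ) * u v j) * X ^ j

/-- `Z(G,λ,u;x) = ∑_{H ⊆ E} λ^H u_{deg(H)} x^{deg(H)}` for a finite multigraph `G`. -/
noncomputable def partitionPoly (G : Graph α β) (hV : G.vertexSet.Finite) (hE : G.edgeSet.Finite)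
    (lam : β → ℂ) (u : α → ℕ → ℂ) : MvPolynomial α ℂ :=
  ∑ H ∈ hE.toFinset.powerset,
    MvPolynomial.C ((∏ e ∈ H, lam e) * ∏ v ∈ hV.toFinset, u v (deg G (H : Set β) v)) *
      ∏ v ∈ hV.toFinset, MvPolynomial.X v ^ deg G (H : Set β) v

/-- `P(y) = F(y^{1/2} 1)`: the univariate polynomial `P` has, at each `y`, the value of `F` when
all variables are set equal to `s`, for every square root `s` of `y`. Such a `P` is unique. -/
def IsSqrtDiagonal (F : MvPolynomial α ℂ) (P : ℂ[X]) : Prop :=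
  ∀ y s : ℂ, s ^ 2 = y → P.eval y = MvPolynomial.eval (fun _ => s) F

/-- `∑_{H ⊆ E} y^{#H} / ∏_v (deg(G,v) choose deg(H,v))`. -/
noncomputable def binomialSum (G : Graph α β) (hV : G.vertexSet.Finite) (hE : G.edgeSet.Finite)
    (y : ℂ) : ℂ :=
  ∑ H ∈ hE.toFinset.powerset,
    y ^ H.card / ∏ v ∈ hV.toFinset, ((deg G G.edgeSet v).choose (deg G (H : Set β) v) : ℂ)

end SubgraphZeros

/-! Call a polynomial disc stable if it has no zeros in the closed unit disc. By Laguerre's theorem,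
replacing the activities `u_j` at a vertex by `u_j + ξ u_{j+1}` with `‖ξ‖ ≤ 1` turns a disc stable
key of degree `d + 1` into a disc stable key of degree `d`. Induct on the edges: if the edge `e` is
removed and both of its ends (twice the same vertex for a loop) are polarized with the same `ξ`, the
partition function of the smaller graph becomes a quadratic polynomial in `ξ` without zeros in the
closed disc. Its constant coefficient `A` is the sum over the `H` avoiding `e`, and its leading
coefficient `B`, multiplied by `λ_e`, is the sum over the `H` containing `e`. As a product of zeros
of modulus greater than one, `A / B` satisfies `‖B‖ < ‖A‖`, so `A + λ_e B ≠ 0`.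

Replacing every `H` by its complement reverses the keys and inverts the edge weights, which
exchanges the inside of the disc with the outside. -/

namespace SubgraphZeros

section DiscStable

/-- A complex polynomial is disc stable if it has no zeros in the closed unit disc. -/
def IsDiscStable (p : ℂ[X]) : Prop :=
  ∀ z : ℂ, ‖z‖ ≤ 1 → p.eval z ≠ 0

theorem IsDiscStable.one_lt_norm_of_mem_roots {p : ℂ[X]} (hp : IsDiscStable p) {r : ℂ}
    (hr : r ∈ p.roots) : 1 < ‖r‖ := by
  by_contra! hle
  exact hp r hle (isRoot_of_mem_roots hr)

theorem isDiscStable_comp_C_mul_X {p : ℂ[X]} {x : ℂ} (h : ∀ z, ‖z‖ ≤ ‖x‖ → p.eval z ≠ 0) :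
    IsDiscStable (p.comp (C x * X)) := by
  intro z hz
  rw [eval_comp, eval_mul, eval_C, eval_X]
  refine h _ ?_
  rw [norm_mul]
  exact mul_le_of_le_one_right (norm_nonneg x) hz

theorem isDiscStable_reflect {p : ℂ[X]} {n : ℕ} (hdeg : p.natDegree ≤ n) (hn : p.coeff n ≠ 0)
    (h : ∀ z, 1 ≤ ‖z‖ → p.eval z ≠ 0) : IsDiscStable (p.reflect n) := by
  intro z hz
  rcases eq_or_ne z 0 with rfl | hz0
  · rwa [← coeff_zero_eq_eval_zero, coeff_reflect, revAt_le n.zero_le]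
  · let := invertibleOfNonzero (inv_ne_zero hz0)
    have hroot := eval₂_reflect_eq_zero_iff (RingHom.id ℂ) z⁻¹ n p hdeg
    rw [invOf_eq_inv, inv_inv] at hroot
    refine fun h0 => h z⁻¹ ?_ (hroot.1 h0)
    rw [norm_inv]
    exact (one_le_inv₀ (norm_pos_iff.2 hz0)).2 hz

theorem one_lt_multiset_prod {R : Type*} [CommSemiring R] [PartialOrder R] [IsStrictOrderedRing R]
    {M : Multiset R} (hM : M ≠ 0) (h : ∀ r ∈ M, 1 < r) : 1 < M.prod := by
  induction M using Multiset.induction_on with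
  | empty => exact absurd rfl hM
  | cons r M ih =>
    rw [Multiset.forall_mem_cons] at h
    rw [Multiset.prod_cons]
    rcases eq_or_ne M 0 with rfl | hM0
    · simpa using h.1
    · exact one_lt_mul_of_lt_of_le h.1 (ih hM0 h.2).le

theorem IsDiscStable.norm_coeff_lt_norm_coeff_zero {p : ℂ[X]} (hp : IsDiscStable p) {n : ℕ}
    (hn : n ≠ 0) (hdeg : p.natDegree ≤ n) : ‖p.coeff n‖ < ‖p.coeff 0‖ := by
  have h0 : p.eval 0 ≠ 0 := hp 0 (by simp)
  rcases hdeg.lt_or_eq with hlt | rfl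
  · rw [coeff_eq_zero_of_natDegree_lt hlt, norm_zero, norm_pos_iff, coeff_zero_eq_eval_zero]
    exact h0
  · have hsplits := IsAlgClosed.splits p
    have hlead : p.leadingCoeff ≠ 0 := by
      rw [leadingCoeff_ne_zero]
      rintro rfl
      exact h0 eval_zero
    have hroots : 1 < ‖p.roots.prod‖ := by
      rw [← normHom_apply, map_multiset_prod]
      refine one_lt_multiset_prod ?_ fun x hx => ?_
      · rwa [Ne, Multiset.map_eq_zero, ← Multiset.card_eq_zero, ← hsplits.natDegree_eq_card_roots]
      · obtain ⟨r, hr, rfl⟩ := Multiset.mem_map.1 hx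
        exact hp.one_lt_norm_of_mem_roots hr
    rw [hsplits.coeff_zero_eq_leadingCoeff_mul_prod_roots, norm_mul, norm_mul, norm_pow, norm_neg,
      norm_one, one_pow, one_mul, coeff_natDegree]
    exact lt_mul_of_one_lt_right (norm_pos_iff.2 hlead) hroots

end DiscStable

section Laguerre

/-- The set consists of `0` and of the numbers `1 / (z - r)` with `1 < ‖r‖`. It is a half plane if
`‖z‖ = 1` and a disc otherwise. -/
theorem convex_setOf_norm_lt_norm_one_sub_mul {z : ℂ} (hz : ‖z‖ ≤ 1) :
    Convex ℝ {w : ℂ | ‖w‖ < ‖1 - z * w‖} := by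
  have hquad : ConvexOn ℝ Set.univ fun w : ℂ => (1 - ‖z‖ ^ 2) * ‖w‖ ^ 2 + 2 * (z * w).re := by
    have hnonneg : 0 ≤ 1 - ‖z‖ ^ 2 := sub_nonneg.2 (pow_le_one₀ (norm_nonneg z) hz)
    have hsq := (convexOn_univ_norm (E := ℂ)).pow (fun w _ => norm_nonneg w) 2
    have hlin := ((2 : ℝ) • Complex.reLm ∘ₗ LinearMap.mulLeft ℝ z).convexOn convex_univ
    exact (hsq.smul hnonneg).add hlin
  convert! hquad.convex_lt 1 using 1
  ext w
  have hexpand : ‖1 - z * w‖ ^ 2 = 1 - 2 * (z * w).re + ‖z‖ ^ 2 * ‖w‖ ^ 2 := by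
    rw [← mul_pow, ← norm_mul, ← Complex.normSq_eq_norm_sq, ← Complex.normSq_eq_norm_sq,
      Complex.normSq_sub]
    simp
    ring
  rw [Set.mem_ofPred_eq, ← sq_lt_sq₀ (norm_nonneg w) (norm_nonneg _), hexpand]
  simp only [Set.mem_univ, true_and, Set.mem_ofPred_eq]
  constructor <;> intro h <;> linarith

theorem multiset_mean_mem_of_convex {𝕜 E : Type*} [Field 𝕜] [LinearOrder 𝕜] [IsStrictOrderedRing 𝕜]
    [AddCommGroup E] [Module 𝕜 E] {s : Set E} (hs : Convex 𝕜 s) {M : Multiset E} (hM : M ≠ 0)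
    (h : ∀ w ∈ M, w ∈ s) : (M.card : 𝕜)⁻¹ • M.sum ∈ s := by
  classical
  have hcard : (M.card : 𝕜) ≠ 0 := Nat.cast_ne_zero.2 (Multiset.card_pos.2 hM).ne'
  have hsum : M.sum = ∑ i ∈ M.toEnumFinset, i.1 := by
    conv_lhs => rw [← M.map_toEnumFinset_fst]
    rfl
  rw [hsum, Finset.smul_sum]
  refine hs.sum_mem (fun _ _ => by positivity) ?_ fun i hi =>
    h _ (Multiset.mem_of_mem_toEnumFinset hi)
  rw [Finset.sum_const, Multiset.card_toEnumFinset, nsmul_eq_mul, mul_inv_cancel₀ hcard]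

theorem norm_one_div_sub_lt {z r : ℂ} (hr : 1 < ‖r‖) (hzr : z ≠ r) :
    ‖1 / (z - r)‖ < ‖1 - z * (1 / (z - r))‖ := by
  have hsub : z - r ≠ 0 := sub_ne_zero.2 hzr
  have hmul : 1 - z * (1 / (z - r)) = -r * (1 / (z - r)) := by
    field_simp
    ring
  rw [hmul, norm_mul, norm_neg]
  exact lt_mul_of_one_lt_left (norm_pos_iff.2 (one_div_ne_zero hsub)) hr

theorem IsDiscStable.norm_mean_logDeriv_lt {p : ℂ[X]} (hp : IsDiscStable p) {n : ℕ} (hn : n ≠ 0)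
    (hdeg : p.natDegree ≤ n) {z : ℂ} (hz : ‖z‖ ≤ 1) :
    ‖(n : ℂ)⁻¹ * (p.derivative.eval z / p.eval z)‖ <
      ‖1 - z * ((n : ℂ)⁻¹ * (p.derivative.eval z / p.eval z))‖ := by
  -- The `n - deg p` padding zeros stand for roots at infinity.
  let M := p.roots.map (fun r => 1 / (z - r)) + Multiset.replicate (n - p.roots.card) 0
  have hcard : M.card = n := by
    simp [M, p.card_roots'.trans hdeg]
  have hsum : M.sum = p.derivative.eval z / p.eval z := by
    rw [(IsAlgClosed.splits p).eval_derivative_div_eval_of_ne_zero (hp z hz)]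
    simp [M]
  have hM : ∀ w ∈ M, w ∈ {w : ℂ | ‖w‖ < ‖1 - z * w‖} := by
    intro w hw
    rcases Multiset.mem_add.1 hw with hw | hw
    · obtain ⟨r, hr, rfl⟩ := Multiset.mem_map.1 hw
      refine norm_one_div_sub_lt (hp.one_lt_norm_of_mem_roots hr) ?_
      rintro rfl
      exact hp z hz (isRoot_of_mem_roots hr)
    · rw [Multiset.eq_of_mem_replicate hw]
      simp
  have hM0 : M ≠ 0 := by
    rwa [← Multiset.card_pos, hcard, Nat.pos_iff_ne_zero]
  have hmean := multiset_mean_mem_of_convex (convex_setOf_norm_lt_norm_one_sub_mul hz) hM0 hM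
  rw [hcard, hsum] at hmean
  simpa using hmean

theorem IsDiscStable.laguerre {p : ℂ[X]} (hp : IsDiscStable p) {n : ℕ} (hn : n ≠ 0)
    (hdeg : p.natDegree ≤ n) {ξ : ℂ} (hξ : ‖ξ‖ ≤ 1) :
    IsDiscStable ((n : ℂ[X]) * p + (C ξ - X) * p.derivative) := by
  intro z hz h0
  simp only [eval_add, eval_mul, eval_sub, eval_natCast, eval_C, eval_X] at h0
  have hpz := hp z hz
  have hnC : (n : ℂ) ≠ 0 := Nat.cast_ne_zero.2 hn
  have hlt := hp.norm_mean_logDeriv_lt hn hdeg hz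
  set q := (n : ℂ)⁻¹ * (p.derivative.eval z / p.eval z) with hq
  have hmul : 1 - z * q = -ξ * q := by
    rw [hq]
    field_simp
    linear_combination h0
  rw [hmul, norm_mul (-ξ), norm_neg] at hlt
  exact hlt.not_ge (mul_le_of_le_one_left (norm_nonneg q) hξ)

end Laguerre

section Key

variable {R : Type*} [CommSemiring R] (d : ℕ) (c : ℕ → R)

/-- The key polynomial `∑ j ≤ d, (d choose j) c_j z ^ j` of the activities `c` at a vertex of
degree `d`; the graph enters `keyPoly` only through `d`. -/
noncomputable def key : R[X] :=
  ∑ j ∈ Finset.range (d + 1), C ((d.choose j : R) * c j) * X ^ j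

/-- The activities `c_j + ξ c_{j+1}`, whose key of degree `d` is, up to a constant factor, the
polar derivative with pole `ξ` of the key of `c` of degree `d + 1`. -/
def polar (ξ : R) : ℕ → R := fun j => c j + ξ * c (j + 1)

theorem coeff_key (j : ℕ) : (key d c).coeff j = d.choose j * c j := by
  simp only [key, finsetSum_coeff, coeff_C_mul_X_pow, Finset.sum_ite_eq, Finset.mem_range]
  split_ifs with hj
  · rfl
  · rw [Nat.choose_eq_zero_of_lt (by omega), Nat.cast_zero, zero_mul]

theorem natDegree_key_le : (key d c).natDegree ≤ d := by
  refine natDegree_le_iff_coeff_eq_zero.2 fun j hj => ?_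
  rw [coeff_key, Nat.choose_eq_zero_of_lt hj, Nat.cast_zero, zero_mul]

theorem degree_key_eq_iff : (key d c).degree = d ↔ (key d c).coeff d ≠ 0 :=
  ⟨coeff_ne_zero_of_eq_degree, fun h => degree_eq_of_le_of_coeff_ne_zero
    (degree_le_of_natDegree_le (natDegree_key_le d c)) h⟩

theorem key_polar (ξ : R) : key d (polar c ξ) = key d c + C ξ * key d fun j => c (j + 1) := by
  ext j
  simp only [coeff_key, coeff_add, coeff_C_mul, polar]
  ring

theorem key_succ : key (d + 1) c = key d c + X * key d fun j => c (j + 1) := by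
  ext (_ | j)
  · simp [coeff_key]
  · simp only [coeff_key, coeff_add, coeff_X_mul, Nat.choose_succ_succ, Nat.cast_add]
    ring

theorem derivative_key_succ :
    (key (d + 1) c).derivative = ((d + 1 : ℕ) : R[X]) * key d fun j => c (j + 1) := by
  ext j
  have hchoose := congrArg (Nat.cast (R := R)) (Nat.add_one_mul_choose_eq d j)
  rw [coeff_derivative, coeff_natCast_mul, coeff_key, coeff_key]
  push_cast at hchoose ⊢
  rw [mul_right_comm, ← hchoose, mul_assoc]

theorem natCast_mul_key_polar {R : Type*} [CommRing R] (d : ℕ) (c : ℕ → R) (ξ : R) :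
    ((d + 1 : ℕ) : R[X]) * key d (polar c ξ) =
      ((d + 1 : ℕ) : R[X]) * key (d + 1) c + (C ξ - X) * (key (d + 1) c).derivative := by
  rw [key_polar, derivative_key_succ, key_succ]
  ring

theorem key_mul_pow (x : R) : (key d fun j => c j * x ^ j) = (key d c).comp (C x * X) := by
  ext j
  rw [comp_C_mul_X_coeff, coeff_key, coeff_key, mul_assoc]

theorem key_reflect : (key d fun j => c (d - j)) = (key d c).reflect d := by
  ext j
  rw [coeff_reflect, coeff_key, coeff_key]
  rcases le_or_gt j d with hj | hj
  · rw [revAt_le hj, Nat.choose_symm hj]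
  · rw [revAt_eq_self_of_lt hj, Nat.choose_eq_zero_of_lt hj, Nat.cast_zero, zero_mul, zero_mul]

theorem IsDiscStable.key_polar {d : ℕ} {c : ℕ → ℂ} (h : IsDiscStable (key (d + 1) c)) {ξ : ℂ}
    (hξ : ‖ξ‖ ≤ 1) : IsDiscStable (key d (polar c ξ)) := by
  intro z hz h0
  refine h.laguerre d.succ_ne_zero (natDegree_key_le _ c) hξ z hz ?_
  rw [← natCast_mul_key_polar, eval_mul, h0, mul_zero]

end Key

section Degree

variable {α β : Type*} (G : Graph α β)

open Classical in
theorem deg_coe_finset_eq_sum_ite (H : Finset β) (v : α) :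
    deg G (H : Set β) v =
      ∑ e ∈ H, ((if G.Inc e v then 1 else 0) + if G.IsLoopAt e v then 1 else 0) := by
  rw [Finset.sum_add_distrib, ← Finset.card_filter, ← Finset.card_filter,
    ← Set.ncard_coe_finset, ← Set.ncard_coe_finset, Finset.coe_filter, Finset.coe_filter]
  rfl

theorem deg_coe_finset (H : Finset β) : deg G (H : Set β) = ∑ e ∈ H, deg G {e} := by
  funext v
  rw [deg_coe_finset_eq_sum_ite, Finset.sum_apply]
  refine Finset.sum_congr rfl fun e _ => ?_
  rw [← Finset.coe_singleton, deg_coe_finset_eq_sum_ite, Finset.sum_singleton]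

theorem deg_sdiff_add [DecidableEq β] {H E : Finset β} (h : H ⊆ E) :
    deg G ((E \ H : Finset β) : Set β) + deg G (H : Set β) = deg G (E : Set β) := by
  simp only [deg_coe_finset, Finset.sum_sdiff h]

theorem deg_le_deg {H E : Finset β} (h : H ⊆ E) : deg G (H : Set β) ≤ deg G (E : Set β) := by
  classical
  rw [← deg_sdiff_add G h]
  exact le_add_self

variable {G} {e : β} {a b : α}

theorem deg_singleton [DecidableEq α] (he : G.IsLink e a b) :
    deg G {e} = Pi.single a 1 + Pi.single b 1 := by
  funext v
  have hinc : G.Inc e v ↔ v = a ∨ v = b :=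
    ⟨fun h => h.eq_or_eq_of_isLink he, by rintro (rfl | rfl); exacts [he.inc_left, he.inc_right]⟩
  have hloop : G.IsLoopAt e v ↔ v = a ∧ v = b := by
    rw [← Graph.isLink_self_iff, he.isLink_iff]
    tauto
  rw [← Finset.coe_singleton, deg_coe_finset_eq_sum_ite, Finset.sum_singleton]
  simp only [hinc, hloop, Pi.add_apply, Pi.single_apply]
  by_cases hva : v = a <;> by_cases hvb : v = b <;> simp [hva, hvb, add_comm]

theorem deg_insert [DecidableEq α] [DecidableEq β] (he : G.IsLink e a b) {H : Finset β}
    (heH : e ∉ H) :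
    deg G (insert e H : Finset β) = deg G (H : Set β) + Pi.single b 1 + Pi.single a 1 := by
  rw [deg_coe_finset, Finset.sum_insert heH, deg_singleton he, ← deg_coe_finset]
  ac_rfl

theorem sum_deg_eq_two_mul_card (hV : G.vertexSet.Finite) {H : Finset β}
    (hH : (H : Set β) ⊆ G.edgeSet) : ∑ v ∈ hV.toFinset, deg G (H : Set β) v = 2 * H.card := by
  classical
  have hends : ∀ e ∈ H, ∑ v ∈ hV.toFinset, deg G {e} v = 2 := by
    intro e he
    obtain ⟨a, b, hab⟩ := G.exists_isLink_of_mem_edgeSet (hH he)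
    simp [deg_singleton hab, Finset.sum_add_distrib, hab.left_mem, hab.right_mem]
  simp only [deg_coe_finset, Finset.sum_apply]
  rw [Finset.sum_comm, Finset.sum_const_nat hends, mul_comm]

end Degree

section SubgraphSum

variable {α β R : Type*} (G : Graph α β)

/-- The functional `f ↦ ∑ H ⊆ E, λ^H f(deg H)` on functions of the degree sequence. The partition
function arises from products of functions of the individual degrees; allowing arbitrary `f` turns
edge insertion and polarization into linear operations on `f`. -/
noncomputable def subgraphSum [CommSemiring R] (lam : β → R) (E : Finset β) :
    ((α → ℕ) → R) →ₗ[R] R :=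
  ∑ H ∈ E.powerset, (∏ e ∈ H, lam e) • LinearMap.proj (deg G (H : Set β))

/-- The product weight `m ↦ ∏ v ∈ V, u_{m v}^{(v)}` of a degree sequence `m`. -/
def activityProd [CommSemiring R] (V : Finset α) (u : α → ℕ → R) (m : α → ℕ) : R :=
  ∏ v ∈ V, u v (m v)

/-- The operator `f ↦ f(· + δ_w)`, the effect on weights of raising the degree of `w` by one. -/
def raise [CommSemiring R] [DecidableEq α] (w : α) : ((α → ℕ) → R) →ₗ[R] (α → ℕ) → R :=
  LinearMap.funLeft R R (· + Pi.single w 1)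

section CommSemiring

variable [CommSemiring R] (lam : β → R) {E : Finset β}

theorem subgraphSum_apply (E : Finset β) (f : (α → ℕ) → R) :
    subgraphSum G lam E f = ∑ H ∈ E.powerset, (∏ e ∈ H, lam e) * f (deg G (H : Set β)) := by
  simp [subgraphSum]

variable {G} in
theorem subgraphSum_insert [DecidableEq α] [DecidableEq β] {e : β} {a b : α}
    (hab : G.IsLink e a b) (he : e ∉ E) (f : (α → ℕ) → R) :
    subgraphSum G lam (insert e E) f =
      subgraphSum G lam E f + lam e * subgraphSum G lam E (raise b (raise a f)) := by
  simp only [subgraphSum_apply, Finset.sum_powerset_insert he, Finset.mul_sum]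
  congr 1
  refine Finset.sum_congr rfl fun H hH => ?_
  have heH : e ∉ H := fun h => he (Finset.mem_powerset.1 hH h)
  rw [Finset.prod_insert heH, deg_insert hab heH, mul_assoc]
  rfl

end CommSemiring

theorem subgraphSum_compl [Semifield R] {lam : β → R} {E : Finset β} (hlam : ∀ e ∈ E, lam e ≠ 0)
    (f : (α → ℕ) → R) :
    subgraphSum G lam E f =
      (∏ e ∈ E, lam e) * subgraphSum G lam⁻¹ E fun m => f (deg G (E : Set β) - m) := by
  classical
  have hprod : ∀ H ⊆ E, ∏ e ∈ H, lam e = (∏ e ∈ E, lam e) * ∏ e ∈ E \ H, lam⁻¹ e := by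
    intro H hH
    have hne : ∏ e ∈ E \ H, lam e ≠ 0 :=
      Finset.prod_ne_zero_iff.2 fun e he => hlam e (Finset.sdiff_subset he)
    simp only [Pi.inv_apply, Finset.prod_inv_distrib]
    rw [← Finset.prod_sdiff hH]
    field_simp
  have hcompl : ∀ H ∈ E.powerset, E \ (E \ H) = H := fun H hH =>
    Finset.sdiff_sdiff_eq_self (Finset.mem_powerset.1 hH)
  have hmem : ∀ H ∈ E.powerset, E \ H ∈ E.powerset := fun H _ =>
    Finset.mem_powerset.2 Finset.sdiff_subset
  simp only [subgraphSum_apply, Finset.mul_sum]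
  refine Finset.sum_nbij' (E \ ·) (E \ ·) hmem hmem hcompl hcompl fun H hH => ?_
  have hHE := Finset.mem_powerset.1 hH
  rw [hprod H hHE, ← deg_sdiff_add G hHE, add_tsub_cancel_left, mul_assoc]

section Polarization

variable [CommSemiring R] [DecidableEq α]

/-- Polarization of the activities at the single vertex `w`. -/
def polarAt (w : α) (ξ : R) (u : α → ℕ → R) : α → ℕ → R :=
  Function.update u w (polar (u w) ξ)

theorem activityProd_polarAt {V : Finset α} {w : α} (hw : w ∈ V) (ξ : R) (u : α → ℕ → R) :
    activityProd V (polarAt w ξ u) = activityProd V u + ξ • raise w (activityProd V u) := by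
  funext m
  have hpolar : ∏ v ∈ V.erase w, polarAt w ξ u v (m v) = ∏ v ∈ V.erase w, u v (m v) :=
    Finset.prod_congr rfl fun v hv => by
      rw [polarAt, Function.update_of_ne (Finset.ne_of_mem_erase hv)]
  have hraise : ∏ v ∈ V.erase w, u v (m v + Pi.single (M := fun _ => ℕ) w 1 v) =
      ∏ v ∈ V.erase w, u v (m v) :=
    Finset.prod_congr rfl fun v hv => by
      rw [Pi.single_eq_of_ne (Finset.ne_of_mem_erase hv), add_zero]
  simp only [activityProd, raise, LinearMap.funLeft_apply, Pi.add_apply, Pi.smul_apply, smul_eq_mul]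
  rw [← Finset.mul_prod_erase V _ hw, ← Finset.mul_prod_erase V (fun v => u v (m v)) hw,
    ← Finset.mul_prod_erase V (fun v => u v (m v + Pi.single (M := fun _ => ℕ) w 1 v)) hw,
    hpolar, hraise, polarAt, Function.update_self, Pi.single_eq_same, polar]
  ring

end Polarization

end SubgraphSum

section Contraction

variable {α β : Type*} {G : Graph α β}

theorem IsDiscStable.key_polarAt [DecidableEq α] {w v : α} {d : ℕ} {u : α → ℕ → ℂ} {ξ : ℂ}
    (hξ : ‖ξ‖ ≤ 1) (h : IsDiscStable (key (d + Pi.single (M := fun _ => ℕ) w 1 v) (u v))) :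
    IsDiscStable (key d (polarAt w ξ u v)) := by
  rcases eq_or_ne v w with rfl | hvw
  · rw [Pi.single_eq_same] at h
    rw [polarAt, Function.update_self]
    exact h.key_polar hξ
  · rw [Pi.single_eq_of_ne hvw, add_zero] at h
    rwa [polarAt, Function.update_of_ne hvw]

theorem norm_map_raise_raise_lt [DecidableEq α] (L : ((α → ℕ) → ℂ) →ₗ[ℂ] ℂ) {V : Finset α}
    {a b : α} (ha : a ∈ V) (hb : b ∈ V) {u : α → ℕ → ℂ}
    (h : ∀ ξ, ‖ξ‖ ≤ 1 → L (activityProd V (polarAt b ξ (polarAt a ξ u))) ≠ 0) :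
    ‖L (raise b (raise a (activityProd V u)))‖ < ‖L (activityProd V u)‖ := by
  let f := activityProd V u
  let p : ℂ[X] := C (L (raise b (raise a f))) * X ^ 2 + C (L (raise a f) + L (raise b f)) * X +
    C (L f)
  have hp : IsDiscStable p := by
    intro ξ hξ h0
    refine h ξ hξ ?_
    rw [activityProd_polarAt hb, activityProd_polarAt ha]
    simp only [map_add, map_smul, smul_eq_mul]
    simp only [p, f, eval_add, eval_mul, eval_pow, eval_C, eval_X] at h0
    linear_combination h0
  simpa [p, coeff_X, coeff_C] using
    hp.norm_coeff_lt_norm_coeff_zero two_ne_zero natDegree_quadratic_le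

theorem subgraphSum_activityProd_ne_zero (hV : G.vertexSet.Finite) {E : Finset β}
    (hE : (E : Set β) ⊆ G.edgeSet) {lam : β → ℂ} (hlam : ∀ e ∈ E, ‖lam e‖ ≤ 1)
    {u : α → ℕ → ℂ} (hu : ∀ v ∈ G.vertexSet, IsDiscStable (key (deg G E v) (u v))) :
    subgraphSum G lam E (activityProd hV.toFinset u) ≠ 0 := by
  classical
  induction E using Finset.induction_on generalizing u with
  | empty =>
    have hu0 : ∀ v ∈ G.vertexSet, u v 0 ≠ 0 := fun v hv => by
      simpa [deg, key] using hu v hv 0 (by simp)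
    simpa [subgraphSum_apply, activityProd, deg, Finset.prod_eq_zero_iff] using hu0
  | insert e E he ih =>
    rw [Finset.coe_insert, Set.insert_subset_iff] at hE
    rw [Finset.forall_mem_insert] at hlam
    obtain ⟨a, b, hab⟩ := G.exists_isLink_of_mem_edgeSet hE.1
    have hlt := norm_map_raise_raise_lt (subgraphSum G lam E) (u := u)
      (hV.mem_toFinset.2 hab.left_mem) (hV.mem_toFinset.2 hab.right_mem) fun ξ hξ =>
        ih hE.2 hlam.2 fun v hv => .key_polarAt hξ <| .key_polarAt hξ <| by
          simpa only [deg_insert hab he, Pi.add_apply, add_right_comm] using hu v hv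
    rw [subgraphSum_insert lam hab he]
    intro h0
    have hnorm := congrArg norm (eq_neg_of_add_eq_zero_left h0)
    rw [norm_neg, norm_mul] at hnorm
    exact hlt.not_ge (hnorm.trans_le (mul_le_of_le_one_left (norm_nonneg _) hlam.1))

end Contraction

section PartitionPoly

variable {α β : Type*} {G : Graph α β} (hV : G.vertexSet.Finite) (hE : G.edgeSet.Finite)
  {lam : β → ℂ} {u : α → ℕ → ℂ}

theorem keyPoly_eq_key (G : Graph α β) (u : α → ℕ → ℂ) (v : α) :
    keyPoly G u v = key (deg G G.edgeSet v) (u v) :=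
  rfl

theorem eval_partitionPoly (lam : β → ℂ) (u : α → ℕ → ℂ) (x : α → ℂ) :
    MvPolynomial.eval x (partitionPoly G hV hE lam u) =
      subgraphSum G lam hE.toFinset (activityProd hV.toFinset fun v j => u v j * x v ^ j) := by
  simp only [partitionPoly, subgraphSum_apply, activityProd, map_sum, map_mul,
    MvPolynomial.eval_C, map_prod, map_pow, MvPolynomial.eval_X, Finset.prod_mul_distrib, mul_assoc]

theorem eval_partitionPoly_ne_zero_of_inside (hlam : ∀ e ∈ G.edgeSet, ‖lam e‖ ≤ 1) {x : α → ℂ}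
    (hx : ∀ v ∈ G.vertexSet, ∀ z, ‖z‖ ≤ ‖x v‖ → (keyPoly G u v).eval z ≠ 0) :
    MvPolynomial.eval x (partitionPoly G hV hE lam u) ≠ 0 := by
  rw [eval_partitionPoly]
  refine subgraphSum_activityProd_ne_zero hV hE.coe_toFinset.subset
    (fun e he => hlam e (hE.mem_toFinset.1 he)) fun v hv => ?_
  rw [hE.coe_toFinset, key_mul_pow]
  exact isDiscStable_comp_C_mul_X (hx v hv)

theorem eval_partitionPoly_ne_zero_of_outside (hlam : ∀ e ∈ G.edgeSet, 1 ≤ ‖lam e‖)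
    (hdeg : ∀ v ∈ G.vertexSet, (keyPoly G u v).degree = deg G G.edgeSet v) {x : α → ℂ}
    (hx0 : ∀ v ∈ G.vertexSet, x v ≠ 0)
    (hx : ∀ v ∈ G.vertexSet, ∀ z, ‖x v‖ ≤ ‖z‖ → (keyPoly G u v).eval z ≠ 0) :
    MvPolynomial.eval x (partitionPoly G hV hE lam u) ≠ 0 := by
  have hlam0 : ∀ e ∈ hE.toFinset, lam e ≠ 0 := fun e he =>
    norm_pos_iff.1 (one_pos.trans_le (hlam e (hE.mem_toFinset.1 he)))
  rw [eval_partitionPoly, subgraphSum_compl G hlam0]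
  refine mul_ne_zero (Finset.prod_ne_zero_iff.2 hlam0)
    (subgraphSum_activityProd_ne_zero (lam := lam⁻¹)
      (u := fun v j => u v (deg G hE.toFinset v - j) * x v ^ (deg G hE.toFinset v - j))
      hV hE.coe_toFinset.subset (fun e he => ?_) fun v hv => ?_)
  · rw [Pi.inv_apply, norm_inv]
    exact inv_le_one_of_one_le₀ (hlam e (hE.mem_toFinset.1 he))
  · rw [hE.coe_toFinset, key_reflect (c := fun j => u v j * x v ^ j), key_mul_pow]
    refine isDiscStable_reflect ?_ ?_ fun z hz => ?_
    · rw [← key_mul_pow]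
      exact natDegree_key_le _ _
    · rw [comp_C_mul_X_coeff]
      exact mul_ne_zero ((degree_key_eq_iff _ _).1 (hdeg v hv)) (pow_ne_zero _ (hx0 v hv))
    · rw [eval_comp, eval_mul, eval_C, eval_X]
      refine hx v hv _ ?_
      rw [norm_mul]
      exact le_mul_of_one_le_right (norm_nonneg _) hz

theorem eval_partitionPoly_const (lam : β → ℂ) (u : α → ℕ → ℂ) (s : ℂ) :
    MvPolynomial.eval (fun _ => s) (partitionPoly G hV hE lam u) =
      ∑ H ∈ hE.toFinset.powerset,
        ((∏ e ∈ H, lam e) * ∏ v ∈ hV.toFinset, u v (deg G (H : Set β) v)) * (s ^ 2) ^ H.card := by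
  simp only [eval_partitionPoly, subgraphSum_apply, activityProd]
  refine Finset.sum_congr rfl fun H hH => ?_
  have hHE : (H : Set β) ⊆ G.edgeSet := hE.subset_toFinset.1 (Finset.mem_powerset.1 hH)
  rw [Finset.prod_mul_distrib, Finset.prod_pow_eq_pow_sum, sum_deg_eq_two_mul_card hV hHE,
    pow_mul, mul_assoc]

theorem exists_isSqrtDiagonal (lam : β → ℂ) (u : α → ℕ → ℂ) :
    ∃ P : ℂ[X], IsSqrtDiagonal (partitionPoly G hV hE lam u) P := by
  refine ⟨∑ H ∈ hE.toFinset.powerset,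
    C ((∏ e ∈ H, lam e) * ∏ v ∈ hV.toFinset, u v (deg G (H : Set β) v)) * X ^ H.card, ?_⟩
  rintro y s rfl
  rw [eval_partitionPoly_const, eval_finsetSum]
  simp only [eval_mul, eval_C, eval_pow, eval_X]

theorem IsSqrtDiagonal.norm_eq_sq_of_isRoot {F : MvPolynomial α ℂ} {P : ℂ[X]}
    (hP : IsSqrtDiagonal F P) {r : ℝ}
    (hF : ∀ s : ℂ, MvPolynomial.eval (fun _ => s) F = 0 → ‖s‖ = r) {y : ℂ} (hy : P.IsRoot y) :
    ‖y‖ = r ^ 2 := by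
  obtain ⟨s, rfl⟩ := IsAlgClosed.exists_pow_nat_eq y two_pos
  rw [norm_pow, hF s ((hP _ s rfl).symm.trans hy)]

section Circle

variable {r : ℝ} (hlam : ∀ e ∈ G.edgeSet, ‖lam e‖ = 1)
  (hkey : ∀ v ∈ G.vertexSet, (keyPoly G u v).degree = (deg G G.edgeSet v : WithBot ℕ) ∧
    ∀ z : ℂ, (keyPoly G u v).IsRoot z → ‖z‖ = r)
include hlam hkey

theorem eval_partitionPoly_ne_zero_of_norm_lt {x : α → ℂ} (hx : ∀ v ∈ G.vertexSet, ‖x v‖ < r) :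
    MvPolynomial.eval x (partitionPoly G hV hE lam u) ≠ 0 :=
  eval_partitionPoly_ne_zero_of_inside hV hE (fun e he => (hlam e he).le) fun v hv z hz h0 =>
    (hz.trans_lt (hx v hv)).ne ((hkey v hv).2 z h0)

theorem eval_partitionPoly_ne_zero_of_lt_norm (hr : 0 ≤ r) {x : α → ℂ}
    (hx : ∀ v ∈ G.vertexSet, r < ‖x v‖) :
    MvPolynomial.eval x (partitionPoly G hV hE lam u) ≠ 0 :=
  eval_partitionPoly_ne_zero_of_outside hV hE (fun e he => (hlam e he).ge)
    (fun v hv => (hkey v hv).1) (fun v hv => norm_pos_iff.1 (hr.trans_lt (hx v hv)))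
    fun v hv z hz h0 => ((hx v hv).trans_le hz).ne' ((hkey v hv).2 z h0)

theorem norm_eq_of_eval_partitionPoly_const_eq_zero (hr : 0 ≤ r) {s : ℂ}
    (hs : MvPolynomial.eval (fun _ => s) (partitionPoly G hV hE lam u) = 0) : ‖s‖ = r := by
  by_contra hne
  rcases lt_or_gt_of_ne hne with hlt | hgt
  · exact eval_partitionPoly_ne_zero_of_norm_lt hV hE hlam hkey (fun _ _ => hlt) hs
  · exact eval_partitionPoly_ne_zero_of_lt_norm hV hE hlam hkey hr (fun _ _ => hgt) hs

theorem partitionPoly_zeros_of_keys_on_circle (hr : 0 ≤ r) :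
    (∀ x : α → ℂ, (∀ v ∈ G.vertexSet, ‖x v‖ < r) →
      MvPolynomial.eval x (partitionPoly G hV hE lam u) ≠ 0) ∧
    (∀ x : α → ℂ, (∀ v ∈ G.vertexSet, r < ‖x v‖) →
      MvPolynomial.eval x (partitionPoly G hV hE lam u) ≠ 0) ∧
    ∃ P : ℂ[X], IsSqrtDiagonal (partitionPoly G hV hE lam u) P ∧
      ∀ y : ℂ, P.IsRoot y → ‖y‖ = r ^ 2 := by
  obtain ⟨P, hP⟩ := exists_isSqrtDiagonal hV hE lam u
  exact ⟨fun x => eval_partitionPoly_ne_zero_of_norm_lt hV hE hlam hkey,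
    fun x => eval_partitionPoly_ne_zero_of_lt_norm hV hE hlam hkey hr, P, hP, fun y =>
      hP.norm_eq_sq_of_isRoot fun s =>
        norm_eq_of_eval_partitionPoly_const_eq_zero hV hE hlam hkey hr⟩

end Circle

end PartitionPoly

section GeomSum

theorem key_eq_geom_sum_iff {K : Type*} [Field K] [CharZero K] {d : ℕ} {c : ℕ → K} :
    key d c = ∑ j ∈ Finset.range (d + 1), X ^ j ↔ ∀ j ≤ d, c j = (d.choose j : K)⁻¹ := by
  have hcoeff : ∀ j, (∑ i ∈ Finset.range (d + 1), X ^ i : K[X]).coeff j =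
      if j ≤ d then 1 else 0 := by
    simp [finsetSum_coeff, coeff_X_pow, Order.lt_add_one_iff]
  simp only [Polynomial.ext_iff, coeff_key, hcoeff]
  refine forall_congr' fun j => ?_
  by_cases hj : j ≤ d
  · have hchoose : (d.choose j : K) ≠ 0 := Nat.cast_ne_zero.2 (Nat.choose_pos hj).ne'
    simp only [hj, if_true, true_imp_iff, mul_comm _ (c j), mul_eq_one_iff_eq_inv₀ hchoose]
  · simp [hj, Nat.choose_eq_zero_of_lt (not_le.1 hj)]

theorem norm_eq_one_of_geom_sum_eq_zero {n : ℕ} {z : ℂ}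
    (h : ∑ j ∈ Finset.range (n + 1), z ^ j = 0) : ‖z‖ = 1 := by
  have hpow := geom_sum_mul z (n + 1)
  rw [h, zero_mul] at hpow
  exact Complex.norm_eq_one_of_pow_eq_one (sub_eq_zero.1 hpow.symm) n.succ_ne_zero

theorem geom_sum_key_on_unit_circle {d : ℕ} {c : ℕ → ℂ}
    (h : key d c = ∑ j ∈ Finset.range (d + 1), X ^ j) :
    (key d c).degree = d ∧ ∀ z : ℂ, (key d c).IsRoot z → ‖z‖ = 1 := by
  refine ⟨(degree_key_eq_iff d c).2 ?_, fun z hz => ?_⟩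
  · simp [h, finsetSum_coeff, coeff_X_pow]
  · rw [h, IsRoot.def, eval_geom_sum] at hz
    exact norm_eq_one_of_geom_sum_eq_zero hz

variable {α β : Type*} {G : Graph α β} (hV : G.vertexSet.Finite) (hE : G.edgeSet.Finite)

theorem eval_partitionPoly_const_eq_binomialSum {u : α → ℕ → ℂ}
    (hu : ∀ v ∈ G.vertexSet, keyPoly G u v = ∑ j ∈ Finset.range (deg G G.edgeSet v + 1), X ^ j)
    (s : ℂ) : MvPolynomial.eval (fun _ => s) (partitionPoly G hV hE (fun _ => 1) u) =
      binomialSum G hV hE (s ^ 2) := by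
  rw [eval_partitionPoly_const, binomialSum]
  refine Finset.sum_congr rfl fun H hH => ?_
  rw [Finset.prod_const_one, one_mul, mul_comm, div_eq_mul_inv, ← Finset.prod_inv_distrib]
  congr 1
  refine Finset.prod_congr rfl fun v hv => ?_
  have hle := deg_le_deg G (Finset.mem_powerset.1 hH) v
  rw [hE.coe_toFinset] at hle
  exact key_eq_geom_sum_iff.1 (hu v (hV.mem_toFinset.1 hv)) _ hle

theorem norm_eq_one_of_binomialSum_eq_zero {y : ℂ} (hy : binomialSum G hV hE y = 0) :
    ‖y‖ = 1 := by
  have hkey : ∀ v, keyPoly G (fun v j => ((deg G G.edgeSet v).choose j : ℂ)⁻¹) v =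
      ∑ j ∈ Finset.range (deg G G.edgeSet v + 1), X ^ j := fun v =>
    key_eq_geom_sum_iff.2 fun _ _ => rfl
  obtain ⟨s, rfl⟩ := IsAlgClosed.exists_pow_nat_eq y two_pos
  rw [← eval_partitionPoly_const_eq_binomialSum hV hE fun v _ => hkey v] at hy
  rw [norm_pow, norm_eq_of_eval_partitionPoly_const_eq_zero hV hE (fun _ _ => norm_one)
    (fun v _ => geom_sum_key_on_unit_circle (hkey v)) zero_le_one hy, one_pow]

end GeomSum

section Trinomial

theorem mul_norm_sq_eq_one_of_quadratic {b t : ℝ} (hbt : b ^ 2 ≤ 4 * t) {w : ℂ}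
    (h : 1 + (b : ℂ) * w + (t : ℂ) * w ^ 2 = 0) : t * ‖w‖ ^ 2 = 1 := by
  have hre := congrArg Complex.re h
  have him := congrArg Complex.im h
  simp only [pow_two, Complex.add_re, Complex.add_im, Complex.mul_re, Complex.mul_im,
    Complex.ofReal_re, Complex.ofReal_im, Complex.one_re, Complex.one_im, Complex.zero_re,
    Complex.zero_im] at hre him
  -- Either `w` is real, hence a double zero, or the two zeros are complex conjugates.
  have hvertex : w.re * (2 * t * w.re + b) = 0 := by
    rcases eq_or_ne w.im 0 with hreal | hnonreal
    · rw [hreal] at hre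
      have hdouble : (2 * t * w.re + b) ^ 2 = 0 := le_antisymm (by nlinarith) (sq_nonneg _)
      rw [pow_eq_zero_iff two_ne_zero |>.1 hdouble, mul_zero]
    · have hconj : w.im * (2 * t * w.re + b) = 0 := by linear_combination him
      rw [(mul_eq_zero.1 hconj).resolve_left hnonreal, mul_zero]
  rw [← Complex.normSq_eq_norm_sq, Complex.normSq_apply]
  linear_combination hvertex - hre

theorem eq_rpow_of_mul_pow_eq_one {x t : ℝ} (hx : 0 ≤ x) {n : ℕ} (hn : n ≠ 0)
    (h : t * x ^ n = 1) : x = t ^ (-1 / (n : ℝ)) := by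
  rw [eq_inv_of_mul_eq_one_left h, neg_div, one_div, Real.rpow_neg (inv_nonneg.2 (pow_nonneg hx n)),
    Real.inv_rpow (pow_nonneg hx n), inv_inv, Real.pow_rpow_inv_natCast hx hn]

theorem norm_eq_rpow_of_trinomial {k : ℕ} (hk : k ≠ 0) {b t : ℝ} (hbt : b ^ 2 ≤ 4 * t) {z : ℂ}
    (h : 1 + (b : ℂ) * z ^ k + (t : ℂ) * z ^ (2 * k) = 0) :
    ‖z‖ = t ^ (-1 / (2 * (k : ℝ))) := by
  have hnorm : t * ‖z‖ ^ (2 * k) = 1 := by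
    rw [pow_mul'] at h ⊢
    simpa using mul_norm_sq_eq_one_of_quadratic hbt h
  exact_mod_cast eq_rpow_of_mul_pow_eq_one (norm_nonneg z) (mul_ne_zero two_ne_zero hk) hnorm

theorem trinomial_key_on_circle {k : ℕ} (hk : k ≠ 0) {b t : ℝ} (ht : t ≠ 0)
    (hbt : b ^ 2 ≤ 4 * t) {c : ℕ → ℂ}
    (h : key (2 * k) c = 1 + C (b : ℂ) * X ^ k + C (t : ℂ) * X ^ (2 * k)) :
    (key (2 * k) c).degree = (2 * k : ℕ) ∧
      ∀ z : ℂ, (key (2 * k) c).IsRoot z → ‖z‖ = t ^ (-1 / (2 * (k : ℝ))) := by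
  refine ⟨(degree_key_eq_iff _ c).2 ?_, fun z hz => norm_eq_rpow_of_trinomial hk hbt ?_⟩
  · have hk2 : 2 * k ≠ k := by omega
    simp [h, coeff_one, hk, hk2, ht]
  · simpa [h] using hz

theorem rpow_neg_one_div_two_mul_sq {t : ℝ} (ht : 0 ≤ t) (a : ℝ) :
    (t ^ (-1 / (2 * a))) ^ 2 = t ^ (-1 / a) := by
  rw [← Real.rpow_mul_natCast ht]
  congr 1
  push_cast
  ring

theorem pos_of_centralBinom_sq_le {k : ℕ} {t : ℝ}
    (h : ((2 * k).choose k : ℝ) ^ 2 ≤ 4 * t) : 0 < t := by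
  have hchoose : 0 < ((2 * k).choose k : ℝ) := by exact_mod_cast k.centralBinom_pos
  linarith [pow_pos hchoose 2]

end Trinomial

end SubgraphZeros

theorem mainTheorem8 {α β : Type*} (G : Graph α β)
    (hV : G.vertexSet.Finite) (hE : G.edgeSet.Finite) :
    -- unit-modulus edge weights, full-degree keys with all zeros on the unit circle
    (∀ (lam : β → ℂ) (u : α → ℕ → ℂ),
      (∀ e ∈ G.edgeSet, ‖lam e‖ = 1) →
      (∀ v ∈ G.vertexSet,
        (SubgraphZeros.keyPoly G u v).degree = (SubgraphZeros.deg G G.edgeSet v : WithBot ℕ) ∧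
        ∀ z : ℂ, (SubgraphZeros.keyPoly G u v).IsRoot z → ‖z‖ = 1) →
      (∀ x : α → ℂ, (∀ v ∈ G.vertexSet, ‖x v‖ < 1) →
        MvPolynomial.eval x (SubgraphZeros.partitionPoly G hV hE lam u) ≠ 0) ∧
      (∀ x : α → ℂ, (∀ v ∈ G.vertexSet, 1 < ‖x v‖) →
        MvPolynomial.eval x (SubgraphZeros.partitionPoly G hV hE lam u) ≠ 0) ∧
      ∃ P : ℂ[X],
        SubgraphZeros.IsSqrtDiagonal (SubgraphZeros.partitionPoly G hV hE lam u) P ∧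
        ∀ y : ℂ, P.IsRoot y → ‖y‖ = 1) ∧
    -- the keys `1 + z + ⋯ + z ^ deg(G,v)` satisfy the hypotheses, and for unit edge weights
    -- they turn `Z(G,1,u;y^{1/2}1)` into the binomial sum
    (∀ u : α → ℕ → ℂ,
      (∀ v ∈ G.vertexSet, SubgraphZeros.keyPoly G u v =
        ∑ j ∈ Finset.range (SubgraphZeros.deg G G.edgeSet v + 1), X ^ j) →
      (∀ v ∈ G.vertexSet,
        (SubgraphZeros.keyPoly G u v).degree = (SubgraphZeros.deg G G.edgeSet v : WithBot ℕ) ∧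
        ∀ z : ℂ, (SubgraphZeros.keyPoly G u v).IsRoot z → ‖z‖ = 1) ∧
      ∀ y s : ℂ, s ^ 2 = y →
        MvPolynomial.eval (fun _ => s)
          (SubgraphZeros.partitionPoly G hV hE (fun _ => 1) u) =
            SubgraphZeros.binomialSum G hV hE y) ∧
    -- hence all zeros of the binomial sum have modulus one
    (∀ y : ℂ, SubgraphZeros.binomialSum G hV hE y = 0 → ‖y‖ = 1) ∧
    -- the keys `1 + (2k choose k) z ^ k + t z ^ (2k)` on a `2k`-regular graph
    (∀ (k : ℕ) (t : ℝ), 1 ≤ k → ((2 * k).choose k : ℝ) ^ 2 ≤ 4 * t →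
      (∀ z : ℂ, 1 + ((2 * k).choose k : ℂ) * z ^ k + (t : ℂ) * z ^ (2 * k) = 0 →
        ‖z‖ = t ^ (-1 / (2 * (k : ℝ)))) ∧
      ∀ (lam : β → ℂ) (u : α → ℕ → ℂ),
        (∀ e ∈ G.edgeSet, ‖lam e‖ = 1) →
        (∀ v ∈ G.vertexSet, SubgraphZeros.deg G G.edgeSet v = 2 * k) →
        (∀ v ∈ G.vertexSet, SubgraphZeros.keyPoly G u v =
          1 + C ((2 * k).choose k : ℂ) * X ^ k + C (t : ℂ) * X ^ (2 * k)) →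
        (∀ x : α → ℂ, (∀ v ∈ G.vertexSet, ‖x v‖ < t ^ (-1 / (2 * (k : ℝ)))) →
          MvPolynomial.eval x (SubgraphZeros.partitionPoly G hV hE lam u) ≠ 0) ∧
        (∀ x : α → ℂ, (∀ v ∈ G.vertexSet, t ^ (-1 / (2 * (k : ℝ))) < ‖x v‖) →
          MvPolynomial.eval x (SubgraphZeros.partitionPoly G hV hE lam u) ≠ 0) ∧
        ∃ P : ℂ[X],
          SubgraphZeros.IsSqrtDiagonal (SubgraphZeros.partitionPoly G hV hE lam u) P ∧
          ∀ y : ℂ, P.IsRoot y → ‖y‖ = t ^ (-1 / (k : ℝ))) := by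
  open SubgraphZeros in
  refine ⟨fun lam u hlam hkey => ?_, fun u hu => ⟨fun v hv => ?_, ?_⟩,
    fun y => norm_eq_one_of_binomialSum_eq_zero hV hE, fun k t hk hkt => ⟨fun z hz => ?_, ?_⟩⟩
  · simpa using partitionPoly_zeros_of_keys_on_circle hV hE hlam hkey zero_le_one
  · exact geom_sum_key_on_unit_circle (hu v hv)
  · rintro y s rfl
    exact eval_partitionPoly_const_eq_binomialSum hV hE hu s
  · exact norm_eq_rpow_of_trinomial (Nat.one_le_iff_ne_zero.1 hk) hkt (by exact_mod_cast hz)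
  · intro lam u hlam hreg hkey
    have ht := pos_of_centralBinom_sq_le hkt
    rw [← rpow_neg_one_div_two_mul_sq ht.le k]
    refine partitionPoly_zeros_of_keys_on_circle hV hE hlam (fun v hv => ?_)
      (Real.rpow_nonneg ht.le _)
    have htrinomial := hkey v hv
    rw [keyPoly_eq_key, hreg v hv] at htrinomial ⊢
    exact trinomial_key_on_circle (Nat.one_le_iff_ne_zero.1 hk) ht.ne' hkt htrinomial
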